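/- Fix $k\ge 0$. A \emph{marked group} is a group $G$ with an ordered generating family $S=(s_1,\dots,s_k)$ (repetitions and trivial elements allowed); its \emph{relations} are the elements of the kernel of the morphism $F_k=F(a_1,\dots,a_k)\to G$, $a_i\mapsto s_i$. The set $\mathcal G_k$ of marked groups up to marking-preserving isomorphism carries the topology in which a neighbourhood basis of $(G,S)$ is given by the sets $N_R(G,S)$ of the marked groups having exactly the same relations of length at most $R$ as $(G,S)$. A \emph{limit group} is a group $\Gamma$ that, for some $k$ and some generating family $S=(s_1,\dots,s_k)$ of $\Gamma$, is a limit in $\mathcal G_k$ of a sequence of marked free groups (of any rank, the markings not necessarily being bases). For a totally ordered abelian group $\Lambda$, a \emph{$\Lambda$-tree} is a set $T$ with a metric $d:T\times T\to\Lambda_{\ge 0}$ (separation, symmetry, triangle inequality) such that any two points are joined by a geodesic segment (an isometric image of a segment $[a,b]\subset\Lambda$), and, for all $x,y,z,u,v\in T$, $d(x,y)+d(u,v)\le\max\{d(x,u)+d(y,v),\,d(x,v)+d(y,u)\}$ and $d(x,y)+d(y,z)-d(x,z)\in 2\Lambda$. An \emph{$\mathbb R^n$-tree} is a $\Lambda$-tree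 for $\Lambda=\mathbb R^n$ with the lexicographic ordering. \textbf{Corollary (Remeslennikov).} For every limit group $\Gamma$ there are an integer $n\ge 0$ and a non-empty $\mathbb R^n$-tree $T$ such that $\Gamma$ acts on $T$ by isometries and freely, that is, no nontrivial element of $\Gamma$ fixes a point of $T$. -/

import Mathlib

open Filter Topology

universe u

/-! ### The space of marked groups -/

/-- A group marked by an ordered generating family `(s₁, …, sₖ)`; repetitions and trivial
generators are allowed. -/
structure MarkedGroup (k : ℕ) : Type (u + 1) where
  carrier : Type u
  [group : Group carrier]
  marking : Fin k → carrier
  generates : Subgroup.closure (Set.range marking) = ⊤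

attribute [instance] MarkedGroup.group

namespace MarkedGroup

variable {k : ℕ}

/-- Two marked groups are isomorphic if some group isomorphism matches the markings. -/
def Iso (G H : MarkedGroup.{u} k) : Prop :=
  ∃ e : G.carrier ≃* H.carrier, ∀ i, e (G.marking i) = H.marking i

instance isoSetoid (k : ℕ) : Setoid (MarkedGroup.{u} k) where
  r := Iso
  iseqv :=
    { refl := fun G => ⟨MulEquiv.refl _, fun _ => rfl⟩
      symm := by
        rintro G H ⟨e, he⟩
        exact ⟨e.symm, fun i => by rw [← he i, e.symm_apply_apply]⟩
      trans := by
        rintro G H K ⟨e, he⟩ ⟨f, hf⟩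
        exact ⟨e.trans f, fun i => by rw [MulEquiv.trans_apply, he i, hf i]⟩ }

/-- The relations of a marked group: the kernel of the natural morphism from the free group on
`(a₁, …, aₖ)` that sends `aᵢ` to `sᵢ`. -/
def relations (G : MarkedGroup.{u} k) : Subgroup (FreeGroup (Fin k)) :=
  (FreeGroup.lift G.marking).ker

theorem relations_eq_of_iso {G H : MarkedGroup.{u} k} (h : Iso G H) :
    G.relations = H.relations := by
  obtain ⟨e, he⟩ := h
  have hcomp : (e.toMonoidHom).comp (FreeGroup.lift G.marking) = FreeGroup.lift H.marking := by
    ext i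
    simp [he]
  ext w
  have hw : e (FreeGroup.lift G.marking w) = FreeGroup.lift H.marking w :=
    DFunLike.congr_fun hcomp w
  simp only [relations, MonoidHom.mem_ker]
  rw [← hw]
  simp

end MarkedGroup

/-- The set `𝒢ₖ` of isomorphism classes of groups marked by `k` generators. -/
def MarkedGroupSpace (k : ℕ) : Type (u + 1) := Quotient (MarkedGroup.isoSetoid.{u} k)

namespace MarkedGroupSpace

variable {k : ℕ}

/-- The isomorphism class of a marked group. -/
def mk (G : MarkedGroup.{u} k) : MarkedGroupSpace.{u} k := Quotient.mk _ G

/-- The relations of an isomorphism class of marked groups. -/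
def relations (x : MarkedGroupSpace.{u} k) : Subgroup (FreeGroup (Fin k)) :=
  Quotient.lift MarkedGroup.relations (fun _ _ h => MarkedGroup.relations_eq_of_iso h) x

/-- `N_R(x)`: the marked groups that have exactly the same relations of length at most `R`
as `x`. -/
def nbhd (R : ℕ) (x : MarkedGroupSpace.{u} k) : Set (MarkedGroupSpace.{u} k) :=
  {y | ∀ w : FreeGroup (Fin k), w.norm ≤ R → (w ∈ x.relations ↔ w ∈ y.relations)}

theorem mem_nbhd_self (R : ℕ) (x : MarkedGroupSpace.{u} k) : x ∈ nbhd R x :=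
  fun _ _ => Iff.rfl

theorem nbhd_anti {R S : ℕ} (h : R ≤ S) (x : MarkedGroupSpace.{u} k) : nbhd S x ⊆ nbhd R x :=
  fun _ hy w hw => hy w (hw.trans h)

/-- The topology in which a set is open if and only if it contains some `N_R(x)` around each of
its points `x`. By `nhds_hasBasis` below, the sets `N_R(x)` form a neighbourhood basis of `x`. -/
instance topology (k : ℕ) : TopologicalSpace (MarkedGroupSpace.{u} k) where
  IsOpen U := ∀ x ∈ U, ∃ R, nbhd R x ⊆ U
  isOpen_univ := fun _ _ => ⟨0, Set.subset_univ _⟩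
  isOpen_inter := by
    rintro U V hU hV x ⟨hxU, hxV⟩
    obtain ⟨R, hR⟩ := hU x hxU
    obtain ⟨S, hS⟩ := hV x hxV
    exact ⟨max R S, fun y hy => ⟨hR (nbhd_anti (le_max_left R S) x hy),
      hS (nbhd_anti (le_max_right R S) x hy)⟩⟩
  isOpen_sUnion := by
    rintro 𝒰 h𝒰 x ⟨U, hU, hxU⟩
    obtain ⟨R, hR⟩ := h𝒰 U hU x hxU
    exact ⟨R, hR.trans (Set.subset_sUnion_of_mem hU)⟩

theorem isOpen_nbhd (R : ℕ) (x : MarkedGroupSpace.{u} k) : IsOpen (nbhd R x) :=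
  fun _ hy => ⟨R, fun _ hz w hw => (hy w hw).trans (hz w hw)⟩

theorem nhds_hasBasis (x : MarkedGroupSpace.{u} k) :
    (𝓝 x).HasBasis (fun _ : ℕ => True) (fun R => nbhd R x) := by
  refine ⟨fun U => ⟨fun hU => ?_, ?_⟩⟩
  · obtain ⟨V, hVU, hV, hxV⟩ := mem_nhds_iff.1 hU
    obtain ⟨R, hR⟩ := hV x hxV
    exact ⟨R, trivial, hR.trans hVU⟩
  · rintro ⟨R, -, hR⟩
    exact mem_nhds_iff.2 ⟨nbhd R x, hR, isOpen_nbhd R x, mem_nbhd_self R x⟩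

end MarkedGroupSpace

/-- A marked group is a limit of free groups if it is the limit, in the space of marked groups,
of a sequence of marked free groups (of any rank; the markings need not be bases). -/
def MarkedGroup.IsLimitOfFree {k : ℕ} (G : MarkedGroup.{u} k) : Prop :=
  ∃ F : ℕ → MarkedGroup.{u} k, (∀ i, IsFreeGroup (F i).carrier) ∧
    Tendsto (fun i => MarkedGroupSpace.mk (F i)) atTop (𝓝 (MarkedGroupSpace.mk G))

/-- A limit group: a group with a finite marking that is a limit of markings of free groups. -/
def IsLimitGroup (Γ : Type u) [Group Γ] : Prop :=
  ∃ (k : ℕ) (s : Fin k → Γ) (hs : Subgroup.closure (Set.range s) = ⊤),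
    (MarkedGroup.mk Γ s hs).IsLimitOfFree

/-! ### `Λ`-trees -/

section LambdaTree

variable (Λ : Type*) [AddCommGroup Λ] [LinearOrder Λ] [IsOrderedAddMonoid Λ]

/-- A metric space with distances in the totally ordered abelian group `Λ`. -/
class LambdaMetricSpace (E : Type*) where
  ldist : E → E → Λ
  ldist_nonneg : ∀ x y, 0 ≤ ldist x y
  ldist_eq_zero : ∀ x y, ldist x y = 0 ↔ x = y
  ldist_comm : ∀ x y, ldist x y = ldist y x
  ldist_triangle : ∀ x y z, ldist x z ≤ ldist x y + ldist y z

open LambdaMetricSpace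

/-- Any two points are joined by a geodesic segment, that is, by an isometric map defined on a
segment `[a, b]` of `Λ`. -/
def IsLambdaGeodesic (E : Type*) [LambdaMetricSpace Λ E] : Prop :=
  ∀ x y : E, ∃ (a b : Λ) (hab : a ≤ b) (γ : Set.Icc a b → E),
    (∀ s t : Set.Icc a b, ldist (γ s) (γ t) = |(s : Λ) - (t : Λ)|) ∧
    γ ⟨a, Set.left_mem_Icc.2 hab⟩ = x ∧ γ ⟨b, Set.right_mem_Icc.2 hab⟩ = y

/-- A `Λ`-tree: a geodesic, `0`-hyperbolic `Λ`-metric space such that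
`d(x, y) + d(y, z) - d(x, z)` always lies in `2Λ`. -/
structure IsLambdaTree (T : Type*) [LambdaMetricSpace Λ T] : Prop where
  geodesic : IsLambdaGeodesic Λ T
  hyperbolic : ∀ x y u v : T, (ldist x y + ldist u v : Λ) ≤
    max (ldist x u + ldist y v) (ldist x v + ldist y u)
  even : ∀ x y z : T, ∃ c : Λ, ldist x y + ldist y z - ldist x z = 2 • c

/-- The group `Γ` acts on `E` by isometries, and no nontrivial element fixes a point. -/
structure IsFreeIsometricAction (Γ E : Type*) [Group Γ] [MulAction Γ E]
    [LambdaMetricSpace Λ E] : Prop where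
  isometric : ∀ (g : Γ) (x y : E), (ldist (g • x) (g • y) : Λ) = ldist x y
  free : ∀ (g : Γ) (x : E), g • x = x → g = 1

end LambdaTree

/-- `ℝⁿ` with its lexicographic ordering, the leftmost coordinate having the greatest weight. -/
abbrev LexReal (n : ℕ) : Type := Lex (Fin n → ℝ)

/-!
The free groups that approximate a limit group `Γ` are represented in `SL₂(ℚ[X])`, and the tree on
which `Γ` acts is obtained as a limit of the Bruhat–Tits trees for the valuation `-deg`.

A countable free group has a representation in `SL₂(ℚ[X])` in which all nontrivial elements have
nonconstant trace (`natDegree_trace_schottkyHom_pos`): the generators are sent to matrices whose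
leading coefficients have rank one and are in general position. The largest degree of an entry is
then a length function on the free group. It is `0`-hyperbolic because of the Plücker relations
between the columns of four matrices (`entryDegree_four_point`), and the Cayley–Hamilton relation
shows that it is larger at `g²` than at `g ≠ 1` (`entryDegree_lt_sq`). Along a sequence of marked
free groups that converges to `Γ`, these functions have an ultralimit, a length function on `Γ` with
values in the hyperreal numbers and with the same properties (`exists_isFreeLength`).

The values of this length function span a rational vector space of finite dimension: `Γ` is finitely
generated, so the entries of its matrices lie in a finitely generated ring, and elements of this
ring with linearly independent valuations are algebraically independent
(`algebraicIndependent_of_linearIndependent`). By the Hahn embedding theorem an ordered rational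
vector space of finite dimension embeds in `ℝⁿ` with the lexicographic ordering
(`exists_strictMono_lexReal`).

Finally, a length function on `Γ` with values in `Λ = ℝⁿ` defines a `0`-hyperbolic pseudometric on
`Γ` that is invariant under left multiplication. Its tight span, suitably defined, is a `Λ`-tree
(`TightSpan.isLambdaTree`) on which `Γ` acts by isometries. An element `g` that fixes a point has
`ℓ (g²) ≤ ℓ g`, so the action is free (`IsFreeLength.isFreeIsometricAction`).
-/

/-! ### The tight span of a `0`-hyperbolic space -/

section TightSpan

variable {Λ X : Type*} [AddCommGroup Λ] [LinearOrder Λ]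

/-- A `0`-hyperbolic `Λ`-valued pseudometric. The triangle inequality is the case `u = v` of the
four-point condition. -/
structure IsZeroHyperbolic (d : X → X → Λ) : Prop where
  self : ∀ x, d x x = 0
  comm : ∀ x y, d x y = d y x
  four_point : ∀ x y u v, d x y + d u v ≤ max (d x u + d y v) (d x v + d y u)

theorem IsZeroHyperbolic.triangle {d : X → X → Λ} (hd : IsZeroHyperbolic d) (x y z : X) :
    d x z ≤ d x y + d y z := by
  have h := hd.four_point x z y y
  rw [hd.self, hd.comm z y, max_self, add_zero] at h
  exact h

/-- The tight span of `d`: the functions `f` that are distance functions `x ↦ d x p` to a point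
`p` on some geodesic between points of `X`. The second condition says that for each `x` such a
geodesic can be chosen to start at `x`. -/
def TightSpan (d : X → X → Λ) : Type _ :=
  {f : X → Λ // (∀ x y, d x y ≤ f x + f y) ∧ ∀ x, ∃ y, f x + f y = d x y}

namespace TightSpan

variable {d : X → X → Λ}

instance : CoeFun (TightSpan d) (fun _ => X → Λ) := ⟨Subtype.val⟩

theorem le_add (f : TightSpan d) (x y : X) : d x y ≤ f x + f y := f.2.1 x y

theorem exists_add_eq (f : TightSpan d) (x : X) : ∃ y, f x + f y = d x y := f.2.2 x

theorem ext {f g : TightSpan d} (h : ∀ x, f x = g x) : f = g := Subtype.ext (funext h)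

variable [IsOrderedAddMonoid Λ]

/-- If `f` lies on a geodesic from `x` to `y`, then `g - f` is bounded by its larger value at
`x` and `y`. -/
theorem sub_le_max (hd : IsZeroHyperbolic d) (f g : TightSpan d) {x y : X}
    (hxy : f x + f y = d x y) (z : X) : g z - f z ≤ max (g x - f x) (g y - f y) := by
  obtain ⟨w, hw⟩ := g.exists_add_eq z
  have := hd.four_point x y z w
  have := f.le_add x z
  have := g.le_add y w
  have := g.le_add x w
  have := f.le_add y z
  grind

/-- The point at distance `s` from `x` on the geodesic from `x` to `y`. -/
def point (hd : IsZeroHyperbolic d) (x y : X) (s : Λ) (h0 : 0 ≤ s) (h1 : s ≤ d x y) :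
    TightSpan d :=
  ⟨fun z => max (d x z - s) (d y z - (d x y - s)), by
    constructor
    · intro z w
      have := hd.four_point x y z w
      grind
    · intro z
      have := hd.self x
      have := hd.self y
      have := hd.comm x y
      have := hd.comm x z
      have := hd.comm y z
      rcases le_total (d y z - (d x y - s)) (d x z - s) with h | h
      · exact ⟨x, by grind⟩
      · exact ⟨y, by grind⟩⟩

theorem point_apply (hd : IsZeroHyperbolic d) (x y : X) (s : Λ) (h0 : 0 ≤ s) (h1 : s ≤ d x y)
    (z : X) : point hd x y s h0 h1 z = max (d x z - s) (d y z - (d x y - s)) := rfl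

/-- A point on a geodesic from `x` to `y` is determined by its distance to `x`. -/
theorem eq_point (hd : IsZeroHyperbolic d) (f : TightSpan d) {x y : X}
    (hxy : f x + f y = d x y) (h0 : 0 ≤ f x) (h1 : f x ≤ d x y) :
    point hd x y (f x) h0 h1 = f := by
  refine ext fun z => ?_
  rw [point_apply]
  obtain ⟨w, hw⟩ := f.exists_add_eq z
  have := hd.four_point x y z w
  have := f.le_add x w
  have := f.le_add y w
  have := f.le_add x z
  have := f.le_add y z
  grind

theorem apply_nonneg (hd : IsZeroHyperbolic d) (f : TightSpan d) (x : X) : 0 ≤ f x := by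
  have := f.le_add x x
  have := hd.self x
  grind

theorem exists_isGreatest (hd : IsZeroHyperbolic d) [Nonempty X] (f g : TightSpan d) :
    ∃ m, IsGreatest (Set.range fun x => g x - f x) m := by
  obtain ⟨x⟩ := ‹Nonempty X›
  obtain ⟨y, hxy⟩ := f.exists_add_eq x
  refine ⟨max (g x - f x) (g y - f y), ?_, ?_⟩
  · rcases max_choice (g x - f x) (g y - f y) with h | h
    · exact ⟨x, h.symm⟩
    · exact ⟨y, h.symm⟩
  · rintro _ ⟨z, rfl⟩
    exact sub_le_max hd f g hxy z

/-- The distance of two points of the tight span: the largest value of `g - f`. -/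
noncomputable def dist (hd : IsZeroHyperbolic d) [Nonempty X] (f g : TightSpan d) : Λ :=
  (exists_isGreatest hd f g).choose

variable [Nonempty X]

theorem le_dist (hd : IsZeroHyperbolic d) (f g : TightSpan d) (x : X) :
    g x - f x ≤ dist hd f g :=
  (exists_isGreatest hd f g).choose_spec.2 ⟨x, rfl⟩

theorem exists_eq_dist (hd : IsZeroHyperbolic d) (f g : TightSpan d) :
    ∃ x, g x - f x = dist hd f g :=
  (exists_isGreatest hd f g).choose_spec.1

/-- Two points of the tight span lie, in this order, on a geodesic between points of `X`. -/
theorem exists_common_pair (hd : IsZeroHyperbolic d) (f g : TightSpan d) :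
    ∃ x y, f x + f y = d x y ∧ g x + g y = d x y ∧ g x - f x = dist hd f g ∧
      f y - g y = dist hd f g := by
  obtain ⟨x, hx⟩ := exists_eq_dist hd f g
  obtain ⟨y, hy⟩ := g.exists_add_eq x
  obtain ⟨z, hz⟩ := exists_eq_dist hd g f
  obtain ⟨w, hw⟩ := f.exists_add_eq z
  have := f.le_add x y
  have := le_dist hd g f y
  have := g.le_add z w
  have := le_dist hd f g w
  refine ⟨x, y, ?_, hy, hx, ?_⟩ <;> grind

theorem dist_comm (hd : IsZeroHyperbolic d) (f g : TightSpan d) :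
    dist hd f g = dist hd g f := by
  obtain ⟨x, y, -, -, -, h⟩ := exists_common_pair hd f g
  obtain ⟨z, w, -, -, -, h'⟩ := exists_common_pair hd g f
  exact le_antisymm (h ▸ le_dist hd g f y) (h' ▸ le_dist hd f g w)

theorem abs_sub_le_dist (hd : IsZeroHyperbolic d) (f g : TightSpan d) (x : X) :
    |f x - g x| ≤ dist hd f g :=
  abs_le'.2 ⟨dist_comm hd f g ▸ le_dist hd g f x, by simpa using le_dist hd f g x⟩

/-- The tight span as a `Λ`-metric space. -/
@[reducible]
noncomputable def lambdaMetricSpace (hd : IsZeroHyperbolic d) :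
    LambdaMetricSpace Λ (TightSpan d) where
  ldist := dist hd
  ldist_nonneg f g := by
    obtain ⟨x⟩ := ‹Nonempty X›
    exact (abs_nonneg _).trans (abs_sub_le_dist hd f g x)
  ldist_eq_zero f g := by
    constructor
    · intro h
      refine ext fun x => sub_eq_zero.1 (abs_nonpos_iff.1 ?_)
      exact h ▸ abs_sub_le_dist hd f g x
    · rintro rfl
      obtain ⟨x, hx⟩ := exists_eq_dist hd f f
      rw [← hx, sub_self]
  ldist_comm := dist_comm hd
  ldist_triangle f g h := by
    obtain ⟨x, hx⟩ := exists_eq_dist hd f h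
    have := le_dist hd f g x
    have := le_dist hd g h x
    grind

theorem dist_point (hd : IsZeroHyperbolic d) (x y : X) (s t : Λ) (hs0 : 0 ≤ s) (hs1 : s ≤ d x y)
    (ht0 : 0 ≤ t) (ht1 : t ≤ d x y) :
    dist hd (point hd x y s hs0 hs1) (point hd x y t ht0 ht1) = |s - t| := by
  have hx := hd.self x
  have hy := hd.self y
  have hc := hd.comm x y
  have key : ∀ (r : Λ) (h0 : 0 ≤ r) (h1 : r ≤ d x y),
      point hd x y r h0 h1 x = r ∧ point hd x y r h0 h1 y = d x y - r := by
    intro r h0 h1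
    constructor <;> rw [point_apply] <;> grind
  obtain ⟨hsx, hsy⟩ := key s hs0 hs1
  obtain ⟨htx, hty⟩ := key t ht0 ht1
  have hpair : point hd x y s hs0 hs1 x + point hd x y s hs0 hs1 y = d x y := by grind
  obtain ⟨z, hz⟩ := exists_eq_dist hd (point hd x y s hs0 hs1) (point hd x y t ht0 ht1)
  have h1 := sub_le_max hd _ (point hd x y t ht0 ht1) hpair z
  have h2 := abs_sub_le_dist hd (point hd x y s hs0 hs1) (point hd x y t ht0 ht1) x
  rw [hsx, htx] at h2 h1
  rw [hsy, hty, hz] at h1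
  refine le_antisymm (h1.trans (max_le ?_ ?_)) h2
  · rw [abs_sub_comm]; exact le_abs_self _
  · simpa using le_abs_self (s - t)

/-- The tight span of a `0`-hyperbolic pseudometric with values in a `2`-divisible group is a
`Λ`-tree. -/
theorem isLambdaTree (hd : IsZeroHyperbolic d) (h2 : ∀ a : Λ, ∃ c, a = 2 • c) :
    letI := lambdaMetricSpace hd
    IsLambdaTree Λ (TightSpan d) := by
  let := lambdaMetricSpace hd
  refine ⟨fun f g => ?_, fun f g h k => ?_, fun f g h => h2 _⟩
  · obtain ⟨x, y, hf, hg, hx, -⟩ := exists_common_pair hd f g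
    have := apply_nonneg hd f x
    have := apply_nonneg hd f y
    have := apply_nonneg hd g x
    have := apply_nonneg hd g y
    have hfg : f x ≤ g x := sub_nonneg.1 (hx ▸ LambdaMetricSpace.ldist_nonneg f g)
    refine ⟨f x, g x, hfg, fun s => point hd x y s (by grind) (by grind),
      fun s t => dist_point hd x y s t _ _ _ _, ?_, ?_⟩
    · exact eq_point hd f hf _ _
    · exact eq_point hd g hg _ _
  · change dist hd f g + dist hd h k ≤
      max (dist hd f h + dist hd g k) (dist hd f k + dist hd g h)
    obtain ⟨x, y, hf, hg, hx, -⟩ := exists_common_pair hd f g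
    obtain ⟨z, w, hh, hk, hz, -⟩ := exists_common_pair hd h k
    have := hd.four_point x y z w
    have := f.le_add x z
    have := le_dist hd h f z
    have := dist_comm hd h f
    have := g.le_add y w
    have := le_dist hd k g w
    have := dist_comm hd k g
    have := f.le_add x w
    have := le_dist hd k f w
    have := dist_comm hd k f
    have := g.le_add y z
    have := le_dist hd h g z
    have := dist_comm hd h g
    grind

end TightSpan

end TightSpan

/-! ### Length functions and free actions -/

section Length

variable {Λ G : Type*} [AddCommGroup Λ] [LinearOrder Λ] [Group G]

/-- A length function `ℓ` with values in `Λ` for which `(x, y) ↦ ℓ (x⁻¹ * y)` is `0`-hyperbolic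
and all nontrivial elements are hyperbolic. -/
structure IsFreeLength (ℓ : G → Λ) : Prop where
  one : ℓ 1 = 0
  inv : ∀ g, ℓ g⁻¹ = ℓ g
  four_point : ∀ x y u v : G, ℓ (x⁻¹ * y) + ℓ (u⁻¹ * v) ≤
    max (ℓ (x⁻¹ * u) + ℓ (y⁻¹ * v)) (ℓ (x⁻¹ * v) + ℓ (y⁻¹ * u))
  lt_sq : ∀ g, g ≠ 1 → ℓ g < ℓ (g * g)

namespace IsFreeLength

variable {ℓ : G → Λ}

theorem isZeroHyperbolic (h : IsFreeLength ℓ) :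
    IsZeroHyperbolic fun x y => ℓ (x⁻¹ * y) where
  self x := by rw [inv_mul_cancel, h.one]
  comm x y := by rw [← h.inv (x⁻¹ * y), mul_inv_rev, inv_inv]
  four_point := h.four_point

/-- Applying a strictly increasing homomorphism, defined on a subgroup that contains all lengths. -/
theorem map {Λ' : Type*} [AddCommGroup Λ'] [LinearOrder Λ'] {V : AddSubgroup Λ}
    (h : IsFreeLength ℓ) (hV : ∀ g, ℓ g ∈ V) (φ : V →+ Λ') (hφ : StrictMono φ) :
    IsFreeLength fun g => φ ⟨ℓ g, hV g⟩ where
  one := by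
    rw [← map_zero φ]
    exact congrArg φ (Subtype.ext h.one)
  inv g := congrArg φ (Subtype.ext (h.inv g))
  four_point x y u v := by
    simp only [← map_add, ← hφ.monotone.map_max, hφ.le_iff_le]
    exact h.four_point x y u v
  lt_sq g hg := hφ (h.lt_sq g hg)

/-- The tight span of the metric defined by a length function. -/
abbrev Tree (_ : IsFreeLength ℓ) : Type _ := TightSpan fun x y : G => ℓ (x⁻¹ * y)

/-- The action on the tight span that extends left multiplication. -/
instance mulAction (h : IsFreeLength ℓ) : MulAction G h.Tree where
  smul g f := ⟨fun x => f (g⁻¹ * x), by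
    constructor
    · intro x y
      simpa [mul_assoc] using f.le_add (g⁻¹ * x) (g⁻¹ * y)
    · intro x
      obtain ⟨y, hy⟩ := f.exists_add_eq (g⁻¹ * x)
      exact ⟨g * y, by simpa [mul_assoc] using hy⟩⟩
  one_smul f := TightSpan.ext fun x => congrArg f (by group)
  mul_smul a b f := TightSpan.ext fun x => congrArg f (by group)

theorem smul_apply (h : IsFreeLength ℓ) (g : G) (f : h.Tree) (x : G) :
    (g • f) x = f (g⁻¹ * x) := rfl

instance nonempty_tree (h : IsFreeLength ℓ) : Nonempty h.Tree :=
  ⟨⟨ℓ, fun x y => by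
      have := h.isZeroHyperbolic.triangle x 1 y
      simpa [h.inv] using this,
    fun x => ⟨1, by simp [h.one, h.inv]⟩⟩⟩

variable [IsOrderedAddMonoid Λ]

theorem isFreeIsometricAction (h : IsFreeLength ℓ) :
    letI := TightSpan.lambdaMetricSpace h.isZeroHyperbolic
    IsFreeIsometricAction Λ G h.Tree := by
  let := TightSpan.lambdaMetricSpace h.isZeroHyperbolic
  have hle : ∀ (g : G) (f f' : h.Tree), TightSpan.dist h.isZeroHyperbolic (g • f) (g • f') ≤
      TightSpan.dist h.isZeroHyperbolic f f' := by
    intro g f f'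
    obtain ⟨x, hx⟩ := TightSpan.exists_eq_dist h.isZeroHyperbolic (g • f) (g • f')
    rw [← hx]
    exact TightSpan.le_dist h.isZeroHyperbolic f f' (g⁻¹ * x)
  refine ⟨fun g f f' => le_antisymm (hle g f f') ?_, fun g f hgf => ?_⟩
  · have := hle g⁻¹ (g • f) (g • f')
    rwa [inv_smul_smul, inv_smul_smul] at this
  · by_contra hg
    -- Choose `w` such that the fixed point `f` lies on a geodesic from `g` to `w`. As `f` is at the
    -- same distance from `1`, `g` and `g²`, the four-point condition for `1, g²; g, w` forces
    -- `ℓ (g²) ≤ ℓ g`.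
    have hf : ∀ x, f (g * x) = f x := fun x => by
      conv_lhs => rw [← hgf]
      rw [smul_apply, inv_mul_cancel_left]
    obtain ⟨w, hw⟩ := f.exists_add_eq g
    have h1 := hf 1
    have h2 := hf g
    have h3 := h.four_point 1 (g * g) g w
    have h4 := f.le_add 1 w
    have h5 := f.le_add (g * g) w
    have h6 := h.lt_sq g hg
    have h7 := h.inv g
    have h8 : (g * g)⁻¹ * g = g⁻¹ := by group
    simp only [inv_one, one_mul, mul_one, h8] at h1 h3 h4
    grind

end IsFreeLength

end Length

/-! ### Degrees of matrices in `SL₂` over a polynomial ring -/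

section EntryDegree

open Matrix Polynomial

variable {R : Type*} [CommRing R]

/-- The largest degree of an entry of a polynomial matrix. On `SL₂` it is half the displacement
of the standard vertex of the Bruhat–Tits tree for the valuation `-deg`. The convention that the
zero polynomial has `natDegree` zero is harmless there, since some entry does not vanish. -/
def entryDegree (M : Matrix (Fin 2) (Fin 2) R[X]) : ℕ :=
  Finset.univ.sup fun p : Fin 2 × Fin 2 => (M p.1 p.2).natDegree

theorem natDegree_le_entryDegree (M : Matrix (Fin 2) (Fin 2) R[X]) (i j : Fin 2) :
    (M i j).natDegree ≤ entryDegree M :=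
  Finset.le_sup (f := fun p : Fin 2 × Fin 2 => (M p.1 p.2).natDegree) (Finset.mem_univ (i, j))

theorem entryDegree_le {M : Matrix (Fin 2) (Fin 2) R[X]} {n : ℕ}
    (h : ∀ i j, (M i j).natDegree ≤ n) : entryDegree M ≤ n :=
  Finset.sup_le fun p _ => h p.1 p.2

theorem exists_natDegree_eq_entryDegree (M : Matrix (Fin 2) (Fin 2) R[X]) :
    ∃ i j, entryDegree M = (M i j).natDegree := by
  obtain ⟨p, -, hp⟩ := Finset.exists_mem_eq_sup Finset.univ Finset.univ_nonempty
    fun p : Fin 2 × Fin 2 => (M p.1 p.2).natDegree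
  exact ⟨p.1, p.2, hp⟩

namespace Matrix.SpecialLinearGroup

/-- The maximal degree is attained at a nonzero entry, also when it is zero. -/
theorem exists_ne_zero_natDegree_eq [Nontrivial R] (g : SpecialLinearGroup (Fin 2) R[X]) :
    ∃ i j, g i j ≠ 0 ∧ (g i j).natDegree = entryDegree (g : Matrix (Fin 2) (Fin 2) R[X]) := by
  obtain ⟨i, j, hij⟩ := exists_natDegree_eq_entryDegree (g : Matrix (Fin 2) (Fin 2) R[X])
  by_cases h : g i j = 0
  · obtain ⟨k, l, hkl⟩ : ∃ k l, g k l ≠ 0 := by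
      by_contra! h0
      have := g.det_coe
      rw [det_fin_two, h0 0 0, h0 0 1] at this
      simp at this
    refine ⟨k, l, hkl, le_antisymm (natDegree_le_entryDegree _ k l) ?_⟩
    rw [hij, h, natDegree_zero]
    exact Nat.zero_le _
  · exact ⟨i, j, h, hij.symm⟩

theorem entryDegree_one : entryDegree (1 : SpecialLinearGroup (Fin 2) R[X]).1 = 0 :=
  Nat.le_zero.1 <| entryDegree_le fun i j => by
    rw [coe_one, one_apply]
    split_ifs <;> simp

theorem entryDegree_inv_le (g : SpecialLinearGroup (Fin 2) R[X]) :
    entryDegree (g⁻¹).1 ≤ entryDegree g.1 := by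
  refine entryDegree_le fun i j => ?_
  have h := natDegree_le_entryDegree g.1
  fin_cases i <;> fin_cases j <;> simpa [coe_inv, adjugate_fin_two] using h _ _

theorem entryDegree_inv (g : SpecialLinearGroup (Fin 2) R[X]) :
    entryDegree (g⁻¹).1 = entryDegree g.1 :=
  le_antisymm (entryDegree_inv_le g) (by simpa using entryDegree_inv_le g⁻¹)

/-- The exterior product of column `i` of `a` and column `j` of `b`. -/
noncomputable def wedge (a b : SpecialLinearGroup (Fin 2) R[X]) (i j : Fin 2) : R[X] :=
  a 0 i * b 1 j - a 1 i * b 0 j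

theorem inv_mul_apply_zero (a b : SpecialLinearGroup (Fin 2) R[X]) (j : Fin 2) :
    (a⁻¹ * b) 0 j = -wedge a b 1 j := by
  simp only [coe_mul, coe_inv, adjugate_fin_two, mul_apply, Fin.sum_univ_two, wedge]
  simp
  ring

theorem inv_mul_apply_one (a b : SpecialLinearGroup (Fin 2) R[X]) (j : Fin 2) :
    (a⁻¹ * b) 1 j = wedge a b 0 j := by
  simp only [coe_mul, coe_inv, adjugate_fin_two, mul_apply, Fin.sum_univ_two, wedge]
  simp
  ring

theorem natDegree_wedge_le (a b : SpecialLinearGroup (Fin 2) R[X]) (i j : Fin 2) :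
    (wedge a b i j).natDegree ≤ entryDegree (a⁻¹ * b).1 := by
  fin_cases i
  · exact inv_mul_apply_one a b j ▸ natDegree_le_entryDegree _ 1 j
  · have := natDegree_le_entryDegree (a⁻¹ * b).1 0 j
    rwa [inv_mul_apply_zero, natDegree_neg] at this

theorem exists_wedge_ne_zero [Nontrivial R] (a b : SpecialLinearGroup (Fin 2) R[X]) :
    ∃ i j, wedge a b i j ≠ 0 ∧ (wedge a b i j).natDegree = entryDegree (a⁻¹ * b).1 := by
  obtain ⟨i, j, h0, h⟩ := exists_ne_zero_natDegree_eq (a⁻¹ * b)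
  fin_cases i
  · refine ⟨1, j, ?_⟩
    simpa only [Fin.zero_eta, inv_mul_apply_zero, natDegree_neg, neg_ne_zero] using And.intro h0 h
  · refine ⟨0, j, ?_⟩
    simpa only [Fin.mk_one, inv_mul_apply_one] using And.intro h0 h

variable [IsDomain R]

/-- The Plücker relation between four columns, one of each matrix, yields the four-point
condition. -/
theorem entryDegree_four_point (a b c e : SpecialLinearGroup (Fin 2) R[X]) :
    entryDegree (a⁻¹ * b).1 + entryDegree (c⁻¹ * e).1 ≤
      max (entryDegree (a⁻¹ * c).1 + entryDegree (b⁻¹ * e).1)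
        (entryDegree (a⁻¹ * e).1 + entryDegree (b⁻¹ * c).1) := by
  obtain ⟨i, j, hij0, hij⟩ := exists_wedge_ne_zero a b
  obtain ⟨k, l, hkl0, hkl⟩ := exists_wedge_ne_zero c e
  have pluecker : wedge a b i j * wedge c e k l =
      wedge a c i k * wedge b e j l - wedge a e i l * wedge b c j k := by
    simp only [wedge]
    ring
  rw [← hij, ← hkl, ← natDegree_mul hij0 hkl0, pluecker]
  refine (natDegree_sub_le _ _).trans (max_le_max ?_ ?_) <;>
  exact natDegree_mul_le.trans
    (add_le_add (natDegree_wedge_le _ _ _ _) (natDegree_wedge_le _ _ _ _))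

/-- An element of nonconstant trace is hyperbolic. -/
theorem entryDegree_lt_sq {g : SpecialLinearGroup (Fin 2) R[X]} (hg : 0 < (trace g.1).natDegree) :
    entryDegree g.1 < entryDegree (g * g).1 := by
  obtain ⟨i, j, h0, h⟩ := exists_ne_zero_natDegree_eq g
  have ht : trace g.1 ≠ 0 := fun h => by simp [h] at hg
  -- The Cayley–Hamilton relation `g² = (tr g) g - 1`.
  have hsq : (g * g) i j = trace g.1 * g i j - (1 : Matrix (Fin 2) (Fin 2) R[X]) i j := by
    have hdet := g.det_coe
    rw [det_fin_two] at hdet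
    rw [coe_mul, mul_apply, Fin.sum_univ_two, trace_fin_two]
    fin_cases i <;> fin_cases j <;> simp <;>
      first | linear_combination -hdet | ring
  have hone : ((1 : Matrix (Fin 2) (Fin 2) R[X]) i j).natDegree = 0 := by
    rw [one_apply]
    split_ifs <;> simp
  have hmul := natDegree_mul ht h0
  have := natDegree_le_entryDegree (g * g).1 i j
  rw [hsq, natDegree_sub_eq_left_of_natDegree_lt (by omega)] at this
  omega

end Matrix.SpecialLinearGroup

end EntryDegree

/-! ### Schottky representations of free groups -/

section Schottky

open Matrix Polynomial

variable {R : Type*} [CommRing R]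

/-- A matrix of determinant `1` whose leading coefficient `(1, p)ᵀ (q, -1)` has rank one. At
infinity it has the attracting direction `(1, p)` and the repelling direction `(1, q)`. -/
noncomputable def schottkyMatrix (p q : R) : Matrix.SpecialLinearGroup (Fin 2) R[X] :=
  ⟨!![C q * X - 1, -X; C (p * q) * X - C p + C q, -C p * X - 1], by
    rw [det_fin_two_of, C_mul]
    ring⟩

/-- The matrix of a letter `x` or `x⁻¹`, where `p (x, true)` and `p (x, false)` give the attracting
directions of `x` and `x⁻¹`. -/
noncomputable def schottkyLetter {ι : Type*} (p : ι × Bool → R) (e : ι × Bool) :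
    Matrix.SpecialLinearGroup (Fin 2) R[X] :=
  cond e.2 (schottkyMatrix (p (e.1, true)) (p (e.1, false)))
    (schottkyMatrix (p (e.1, true)) (p (e.1, false)))⁻¹

variable {ι : Type*} (p : ι × Bool → R)

theorem coe_schottkyLetter_true (x : ι) : (schottkyLetter p (x, true)).1 =
    !![C (p (x, false)) * X - 1, -X; C (p (x, true) * p (x, false)) * X - C (p (x, true)) +
      C (p (x, false)), -C (p (x, true)) * X - 1] := rfl

theorem coe_schottkyLetter_false (x : ι) : (schottkyLetter p (x, false)).1 =
    !![-C (p (x, true)) * X - 1, X; -(C (p (x, true) * p (x, false)) * X - C (p (x, true)) +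
      C (p (x, false))), C (p (x, false)) * X - 1] :=
  (adjugate_fin_two_of _ _ _ _).trans (by rw [neg_neg])

theorem natDegree_schottkyLetter_le (e : ι × Bool) (i j : Fin 2) :
    ((schottkyLetter p e).1 i j).natDegree ≤ 1 := by
  obtain ⟨x, b⟩ := e
  cases b
  · rw [coe_schottkyLetter_false]
    fin_cases i <;> fin_cases j <;> simp <;> compute_degree
  · rw [coe_schottkyLetter_true]
    fin_cases i <;> fin_cases j <;> simp <;> compute_degree

theorem coeff_one_schottkyLetter (e : ι × Bool) (i j : Fin 2) :
    ((schottkyLetter p e).1 i j).coeff 1 =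
      cond e.2 1 (-1) * ![1, p e] i * ![p (e.1, !e.2), -1] j := by
  obtain ⟨x, b⟩ := e
  cases b
  · rw [coe_schottkyLetter_false, mul_comm (p (x, true))]
    fin_cases i <;> fin_cases j <;> simp [coeff_one, coeff_C, -map_mul]
  · rw [coe_schottkyLetter_true]
    fin_cases i <;> fin_cases j <;> simp [coeff_one, coeff_C, -map_mul]

theorem natDegree_prod_schottkyLetter_le (L : List (ι × Bool)) (i j : Fin 2) :
    ((L.map (schottkyLetter p)).prod.1 i j).natDegree ≤ L.length := by
  induction L generalizing i with
  | nil =>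
    rw [List.map_nil, List.prod_nil, Matrix.SpecialLinearGroup.coe_one, one_apply]
    split_ifs <;> simp
  | cons e L ih =>
    rw [List.map_cons, List.prod_cons, Matrix.SpecialLinearGroup.coe_mul, mul_apply]
    refine natDegree_sum_le_of_forall_le _ _ fun k _ => natDegree_mul_le.trans ?_
    have := natDegree_schottkyLetter_le p e i k
    have := ih k
    rw [List.length_cons]
    omega

/-- The representation of a free group by Schottky matrices. -/
noncomputable def schottkyHom : FreeGroup ι →* Matrix.SpecialLinearGroup (Fin 2) R[X] :=
  FreeGroup.lift fun x => schottkyMatrix (p (x, true)) (p (x, false))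

theorem schottkyHom_mk (L : List (ι × Bool)) :
    schottkyHom p (FreeGroup.mk L) = (L.map (schottkyLetter p)).prod :=
  FreeGroup.lift_mk

variable [IsDomain R]

/-- The coefficient of top degree of a reduced word is the product of the rank one leading
coefficients of its letters, which does not vanish because the kernel of each factor differs from
the image of the next. -/
theorem coeff_prod_schottkyLetter {p : ι × Bool → R} (hp : Function.Injective p) (e : ι × Bool)
    (L : List (ι × Bool)) (hL : FreeGroup.IsReduced (e :: L)) :
    ∃ c : R, c ≠ 0 ∧ ∀ i j, (((e :: L).map (schottkyLetter p)).prod.1 i j).coeff (L.length + 1) =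
      c * ![1, p e] i *
        ![p (((e :: L).getLast (by simp)).1, !((e :: L).getLast (by simp)).2), -1] j := by
  induction L generalizing e with
  | nil =>
    refine ⟨cond e.2 1 (-1), by cases e.2 <;> simp, fun i j => ?_⟩
    simpa using coeff_one_schottkyLetter p e i j
  | cons f L ih =>
    rw [FreeGroup.IsReduced, List.isChain_cons_cons] at hL
    obtain ⟨c, hc0, hc⟩ := ih f hL.2
    refine ⟨cond e.2 1 (-1) * c * (p (e.1, !e.2) - p f), ?_, fun i j => ?_⟩
    · refine mul_ne_zero (mul_ne_zero (by cases e.2 <;> simp) hc0) (sub_ne_zero.2 fun h => ?_)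
      have hf := hp h
      have := hL.1 (by rw [← hf])
      rw [← hf] at this
      cases h2 : e.2 <;> simp [h2] at this
    · rw [List.map_cons, List.prod_cons, Matrix.SpecialLinearGroup.coe_mul, mul_apply,
        finsetSum_coeff, List.length_cons, add_comm (L.length + 1) 1]
      have hmul : ∀ k, ((schottkyLetter p e).1 i k *
          ((f :: L).map (schottkyLetter p)).prod.1 k j).coeff (1 + (L.length + 1)) = _ := fun k =>
        coeff_mul_add_eq_of_natDegree_le (natDegree_schottkyLetter_le p e i k)
          (natDegree_prod_schottkyLetter_le p (f :: L) k j)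
      simp only [hmul, coeff_one_schottkyLetter, Fin.sum_univ_two, hc]
      rw [List.getLast_cons (by simp : f :: L ≠ [])]
      simp only [cons_val_zero, cons_val_one]
      ring

/-- A nontrivial element is conjugate to a nonempty cyclically reduced word, whose top coefficient
has nonzero trace because its last letter is not the inverse of the first. -/
theorem natDegree_trace_schottkyHom_pos {p : ι × Bool → R} (hp : Function.Injective p)
    {g : FreeGroup ι} (hg : g ≠ 1) : 0 < (trace (schottkyHom p g).1).natDegree := by
  classical
  set L := FreeGroup.reduceCyclically g.toWord
  set u := FreeGroup.mk (FreeGroup.reduceCyclically.conjugator g.toWord)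
  have hgL : g = u * FreeGroup.mk L * u⁻¹ := by
    conv_lhs => rw [← FreeGroup.mk_toWord (x := g),
      ← FreeGroup.reduceCyclically.conj_conjugator_reduceCyclically g.toWord]
    rw [← FreeGroup.mul_mk, ← FreeGroup.mul_mk, ← FreeGroup.inv_mk]
  have htr : trace (schottkyHom p g).1 = trace (L.map (schottkyLetter p)).prod.1 := by
    rw [hgL, map_mul, map_mul, Matrix.SpecialLinearGroup.coe_mul, Matrix.SpecialLinearGroup.coe_mul,
      trace_mul_cycle, ← Matrix.SpecialLinearGroup.coe_mul, ← map_mul, inv_mul_cancel, map_one,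
      Matrix.SpecialLinearGroup.coe_one, one_mul, schottkyHom_mk]
  have hcyc : FreeGroup.IsCyclicallyReduced L :=
    FreeGroup.reduceCyclically.isCyclicallyReduced FreeGroup.isReduced_toWord
  rw [htr]
  clear htr
  rcases hL : L with _ | ⟨e, L'⟩
  · refine absurd ?_ hg
    rw [hgL, hL, ← FreeGroup.one_eq_mk, mul_one, mul_inv_cancel]
  · rw [hL] at hcyc
    obtain ⟨c, hc0, hc⟩ := coeff_prod_schottkyLetter hp e L' hcyc.1
    refine lt_of_lt_of_le (Nat.succ_pos L'.length) (le_natDegree_of_ne_zero ?_)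
    rw [trace_fin_two, coeff_add, hc, hc]
    set l := (e :: L').getLast (by simp)
    have hl : l.1 = e.1 → l.2 = e.2 := hcyc.2 l (List.getLast?_eq_getLast_of_ne_nil _) e (by simp)
    have : c * (p (l.1, !l.2) - p e) ≠ 0 := by
      refine mul_ne_zero hc0 (sub_ne_zero.2 fun h => ?_)
      have he := hp h
      rw [← he] at hl
      cases h2 : l.2 <;> simp [h2] at hl
    convert this using 1
    simp only [cons_val_zero, cons_val_one]
    ring

end Schottky

/-! ### Asymptotic degrees have finite rational rank -/

section AsymptoticDegree

open Polynomial

variable {σ : Type*} (s : ℕ → σ → ℚ[X])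

/-- The hyperreal number represented by the degrees of the values of `P` at a sequence of points
with coordinates in `ℚ[X]`; it is `0` if these values vanish for almost all indices. -/
noncomputable def asymptoticDegree (P : MvPolynomial σ ℚ) : Hyperreal :=
  Hyperreal.ofSeq fun n => ((MvPolynomial.aeval (s n) P).natDegree : ℝ)

theorem Hyperreal.ofSeq_eq_ofSeq {f g : ℕ → ℝ} :
    Hyperreal.ofSeq f = Hyperreal.ofSeq g ↔ ∀ᶠ n in hyperfilter ℕ, f n = g n :=
  Germ.coe_eq

theorem eventually_aeval_ne_zero {P : MvPolynomial σ ℚ} (hP : asymptoticDegree s P ≠ 0) :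
    ∀ᶠ n in hyperfilter ℕ, MvPolynomial.aeval (s n) P ≠ 0 := by
  rw [Ultrafilter.eventually_not]
  intro h
  refine hP (Hyperreal.ofSeq_eq_ofSeq.2 (h.mono fun n hn => ?_) : _ = Hyperreal.ofSeq 0)
  simp [hn]

theorem linearCombination_asymptoticDegree {ι : Type*} (P : ι → MvPolynomial σ ℚ) (m : ι →₀ ℕ) :
    Finsupp.linearCombination ℕ (fun j => asymptoticDegree s (P j)) m = Hyperreal.ofSeq fun n =>
      ((m.sum fun j e => e * (MvPolynomial.aeval (s n) (P j)).natDegree : ℕ) : ℝ) := by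
  let c : (ℕ → ℝ) →+* Hyperreal := Germ.coeRingHom _
  change (m.sum fun j e => e • c _) = c _
  simp only [Finsupp.sum, ← map_nsmul, ← map_sum]
  congr 1
  ext n
  simp

/-- A nonzero sum of monomials in the `f j` vanishes only if two of the monomials have the same
degree. -/
theorem exists_sum_natDegree_eq {ι : Type*} {Q : MvPolynomial ι ℚ} (hQ : Q ≠ 0) {f : ι → ℚ[X]}
    (hf : ∀ m ∈ Q.support, ∀ j ∈ m.support, f j ≠ 0) (h0 : MvPolynomial.aeval f Q = 0) :
    ∃ m ∈ Q.support, ∃ m' ∈ Q.support, m ≠ m' ∧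
      m.sum (fun j e => e * (f j).natDegree) = m'.sum fun j e => e * (f j).natDegree := by
  by_contra! hne
  have hprod : ∀ m ∈ Q.support, (m.prod fun j e => f j ^ e) ≠ 0 := fun m hm =>
    Finset.prod_ne_zero_iff.2 fun j hj => pow_ne_zero _ (hf m hm j hj)
  have hcoeff : ∀ m ∈ Q.support, C (Q.coeff m) ≠ 0 := fun m hm =>
    C_ne_zero.2 (MvPolynomial.mem_support_iff.1 hm)
  have hdeg : ∀ m ∈ Q.support, (C (Q.coeff m) * m.prod fun j e => f j ^ e).degree =
      ((m.sum fun j e => e * (f j).natDegree : ℕ) : WithBot ℕ) := by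
    intro m hm
    rw [degree_eq_natDegree (mul_ne_zero (hcoeff m hm) (hprod m hm)),
      natDegree_mul (hcoeff m hm) (hprod m hm), natDegree_C, zero_add, Finsupp.prod,
      natDegree_prod _ _ fun j hj => pow_ne_zero _ (hf m hm j hj)]
    simp only [natDegree_pow]
    rfl
  have hsum := degree_sum_eq_of_disjoint
    (fun m : ι →₀ ℕ => C (Q.coeff m) * m.prod fun j e => f j ^ e) Q.support (by
      rintro m ⟨hm, -⟩ m' ⟨hm', -⟩ hmm'
      simp only [Function.onFun, Function.comp_apply, hdeg m hm, hdeg m' hm']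
      exact fun h => hne m hm m' hm' hmm' (by exact_mod_cast h))
  have hQ0 : ∑ m ∈ Q.support, C (Q.coeff m) * m.prod (fun j e => f j ^ e) = 0 := by
    rw [← h0, MvPolynomial.aeval_def, MvPolynomial.eval₂_eq, Polynomial.algebraMap_eq]
    rfl
  rw [hQ0, degree_zero, eq_comm, Finset.sup_eq_bot_iff] at hsum
  obtain ⟨m, hm⟩ := MvPolynomial.support_nonempty.2 hQ
  have := hsum m hm
  rw [hdeg m hm] at this
  exact WithBot.natCast_ne_bot _ this

/-- The analogue of Abhyankar's inequality: elements with linearly independent valuations are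
algebraically independent. -/
theorem algebraicIndependent_of_linearIndependent {ι : Type*} {P : ι → MvPolynomial σ ℚ}
    (hP : LinearIndependent ℚ fun j => asymptoticDegree s (P j)) : AlgebraicIndependent ℚ P := by
  rw [algebraicIndependent_iff]
  intro Q hQ
  by_contra hQ0
  have hne : ∀ᶠ n in hyperfilter ℕ, ∀ m ∈ Q.support, ∀ j ∈ m.support,
      MvPolynomial.aeval (s n) (P j) ≠ 0 := by
    refine (eventually_all_finset _).2 fun m _ => (eventually_all_finset _).2 fun j _ => ?_
    exact eventually_aeval_ne_zero s (hP.ne_zero j)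
  have hex : ∀ᶠ n in hyperfilter ℕ, ∃ m ∈ Q.support, ∃ m' ∈ Q.support, m ≠ m' ∧
      m.sum (fun j e => e * (MvPolynomial.aeval (s n) (P j)).natDegree) =
        m'.sum fun j e => e * (MvPolynomial.aeval (s n) (P j)).natDegree := by
    refine hne.mono fun n hn => exists_sum_natDegree_eq hQ0 hn ?_
    rw [← MvPolynomial.comp_aeval_apply, hQ, map_zero]
  obtain ⟨m, -, h⟩ := (Ultrafilter.eventually_exists_mem_iff Q.support.finite_toSet).1 hex
  obtain ⟨m', -, h⟩ := (Ultrafilter.eventually_exists_mem_iff Q.support.finite_toSet).1 h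
  have hinj : LinearIndependent ℕ fun j => asymptoticDegree s (P j) :=
    hP.restrict_scalars (fun a b h => by simpa using h)
  obtain ⟨n, hmm', -⟩ := h.exists
  refine hmm' (hinj ?_)
  rw [linearCombination_asymptoticDegree, linearCombination_asymptoticDegree,
    Hyperreal.ofSeq_eq_ofSeq]
  exact h.mono fun n hn => congrArg _ hn.2

/-- The asymptotic degrees span a rational vector space of dimension at most the transcendence
degree of `MvPolynomial σ ℚ`. -/
theorem finiteDimensional_span_asymptoticDegree [Finite σ] :
    FiniteDimensional ℚ (Submodule.span ℚ (Set.range (asymptoticDegree s))) := by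
  obtain ⟨b, hb, hspan, hli⟩ := exists_linearIndependent ℚ (Set.range (asymptoticDegree s))
  choose P hP using fun x : b => hb x.2
  have hind : AlgebraicIndependent ℚ P :=
    algebraicIndependent_of_linearIndependent s (by simpa only [hP] using hli)
  have hcard := hind.lift_cardinalMk_le_trdeg
  rw [MvPolynomial.trdeg_of_isDomain] at hcard
  have hfin : Finite b := by
    rw [← Cardinal.mk_lt_aleph0_iff, ← Cardinal.lift_lt_aleph0]
    refine hcard.trans_lt ?_
    simp
  rw [← hspan]
  exact FiniteDimensional.span_of_finite ℚ (Set.toFinite b)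

end AsymptoticDegree

/-! ### Embedding ordered rational vector spaces of finite dimension in `ℝⁿ` -/

section Hahn

variable {M : Type*} [AddCommGroup M] [LinearOrder M] [IsOrderedAddMonoid M] [Module ℚ M]
  [IsOrderedModule ℚ M]

/-- Nonzero elements of distinct archimedean classes are linearly independent. -/
theorem linearIndependent_of_injective_archimedeanClass {ι : Type*} {v : ι → M}
    (h0 : ∀ i, v i ≠ 0) (hv : Function.Injective fun i => ArchimedeanClass.mk (v i)) :
    LinearIndependent ℚ v := by
  let : LinearOrder ι := LinearOrder.lift' _ hv
  rw [linearIndependent_iff']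
  intro s c hsum
  by_contra! hne
  obtain ⟨i, hi, hci⟩ := hne
  have hnonempty : (s.filter fun i => c i ≠ 0).Nonempty := ⟨i, Finset.mem_filter.2 ⟨hi, hci⟩⟩
  have hmk : ∀ j ∈ s.filter (fun i => c i ≠ 0),
      ArchimedeanClass.mk (c j • v j) = ArchimedeanClass.mk (v j) := fun j hj =>
    ArchimedeanClass.mk_smul _ (Finset.mem_filter.1 hj).2
  have hmin := ArchimedeanClass.mk_sum hnonempty (a := fun j => c j • v j) (by
    intro j hj k hk hjk
    simp only [Function.comp_apply, hmk j hj, hmk k hk]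
    exact hjk)
  have hfilter : ∑ j ∈ s with c j ≠ 0, c j • v j = ∑ j ∈ s, c j • v j :=
    Finset.sum_filter_of_ne fun j _ hj hc => hj (by rw [hc, zero_smul])
  rw [hmk _ (Finset.min'_mem _ _), hfilter, hsum, ArchimedeanClass.mk_zero, eq_comm,
    ArchimedeanClass.mk_eq_top_iff] at hmin
  exact h0 _ hmin

theorem finite_finiteArchimedeanClass [FiniteDimensional ℚ M] :
    Finite (FiniteArchimedeanClass M) := by
  choose v hv using fun c : FiniteArchimedeanClass M => ArchimedeanClass.mk_surjective M c.1
  have hli : LinearIndependent ℚ v := by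
    refine linearIndependent_of_injective_archimedeanClass (fun c hc => c.2 ?_) fun c c' h => ?_
    · rw [← hv c, hc, ArchimedeanClass.mk_zero]
    · exact Subtype.ext (by rw [← hv c, ← hv c']; exact h)
  exact hli.finite

/-- A totally ordered rational vector space of finite dimension embeds in some `ℝⁿ` with the
lexicographic ordering. -/
theorem exists_strictMono_lexReal [FiniteDimensional ℚ M] :
    ∃ (n : ℕ) (φ : M →+ LexReal n), StrictMono φ := by
  have := finite_finiteArchimedeanClass (M := M)
  have := Fintype.ofFinite (FiniteArchimedeanClass M)
  let e : Fin (Fintype.card (FiniteArchimedeanClass M)) ≃o FiniteArchimedeanClass M :=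
    Fintype.orderIsoFinOfCardEq _ rfl
  obtain ⟨f, hf, -⟩ := hahnEmbedding_isOrderedModule_rat M
  refine ⟨_, ⟨⟨fun x => toLex fun i => (ofLex (f x)).coeff (e i), ?_⟩, ?_⟩, ?_⟩
  · funext i
    change (ofLex (f 0)).coeff (e i) = 0
    rw [map_zero]
    rfl
  · intro x y
    funext i
    change (ofLex (f (x + y))).coeff (e i) = _
    rw [map_add]
    rfl
  · intro x y hxy
    obtain ⟨c, hc, hlt⟩ := (HahnSeries.lt_iff _ _).1 (hf hxy)
    refine ⟨e.symm c, fun j hj => hc (e j) ?_, ?_⟩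
    · exact e.lt_symm_apply.1 hj
    · change (ofLex (f x)).coeff (e (e.symm c)) < (ofLex (f y)).coeff (e (e.symm c))
      rwa [e.apply_symm_apply]

end Hahn

/-! ### Limits of representations in `SL₂` -/

section Limit

open Matrix Polynomial

/-- The degrees of the matrices in a sequence of representations `ψ n : W →* SL₂(R[X])` define a
hyperreal length function on the quotient of `W` by the elements that `ψ n` kills for almost all
`n`, provided that all other elements have images of nonconstant trace for almost all `n`. -/
theorem exists_isFreeLength {R W Γ : Type*} [CommRing R] [IsDomain R] [Group W] [Group Γ]
    {π : W →* Γ} (hπ : Function.Surjective π)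
    (ψ : ℕ → W →* Matrix.SpecialLinearGroup (Fin 2) R[X])
    (hone : ∀ w, π w = 1 → ∀ᶠ n in hyperfilter ℕ, ψ n w = 1)
    (htrace : ∀ w, π w ≠ 1 → ∀ᶠ n in hyperfilter ℕ, 0 < (trace (ψ n w).1).natDegree) :
    ∃ ℓ : Γ → Hyperreal, IsFreeLength ℓ ∧
      ∀ w, ℓ (π w) = Hyperreal.ofSeq fun n => (entryDegree (ψ n w).1 : ℝ) := by
  have hlift : ∀ w w', π w = π w' → (Hyperreal.ofSeq fun n => (entryDegree (ψ n w).1 : ℝ)) =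
      Hyperreal.ofSeq fun n => (entryDegree (ψ n w').1 : ℝ) := by
    intro w w' h
    have h1 : π (w⁻¹ * w') = 1 := by rw [map_mul, map_inv, h, inv_mul_cancel]
    refine Hyperreal.ofSeq_eq_ofSeq.2 ((hone _ h1).mono fun n hn => ?_)
    rw [map_mul, map_inv, inv_mul_eq_one] at hn
    rw [hn]
  set ℓ : Γ → Hyperreal := fun g =>
    Hyperreal.ofSeq fun n => (entryDegree (ψ n (Function.surjInv hπ g)).1 : ℝ)
  have hℓ : ∀ w, ℓ (π w) = Hyperreal.ofSeq fun n => (entryDegree (ψ n w).1 : ℝ) :=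
    fun w => hlift _ _ (Function.surjInv_eq hπ _)
  refine ⟨ℓ, ⟨?_, ?_, ?_, ?_⟩, hℓ⟩
  · rw [← map_one π, hℓ]
    refine (Hyperreal.ofSeq_eq_ofSeq.2 (.of_forall fun n => ?_) : _ = Hyperreal.ofSeq 0)
    rw [map_one, Matrix.SpecialLinearGroup.entryDegree_one]
    simp
  · intro g
    obtain ⟨w, rfl⟩ := hπ g
    rw [← map_inv, hℓ, hℓ, Hyperreal.ofSeq_eq_ofSeq]
    exact .of_forall fun n => by rw [map_inv, Matrix.SpecialLinearGroup.entryDegree_inv]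
  · intro x y u v
    obtain ⟨x, rfl⟩ := hπ x
    obtain ⟨y, rfl⟩ := hπ y
    obtain ⟨u, rfl⟩ := hπ u
    obtain ⟨v, rfl⟩ := hπ v
    simp only [← map_inv, ← map_mul, hℓ]
    rw [le_max_iff]
    refine Or.imp Hyperreal.ofSeq_le_ofSeq.2 Hyperreal.ofSeq_le_ofSeq.2
      (Ultrafilter.eventually_or.1 (.of_forall fun n => ?_))
    have := Matrix.SpecialLinearGroup.entryDegree_four_point (ψ n x) (ψ n y) (ψ n u) (ψ n v)
    rw [le_max_iff] at this
    simp only [← map_inv, ← map_mul] at this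
    beta_reduce
    exact_mod_cast this
  · intro g hg
    obtain ⟨w, rfl⟩ := hπ g
    rw [← map_mul, hℓ, hℓ, Hyperreal.ofSeq_lt_ofSeq]
    refine (htrace w hg).mono fun n hn => ?_
    rw [map_mul]
    exact_mod_cast Matrix.SpecialLinearGroup.entryDegree_lt_sq hn

variable {ι : Type*} (ψ : ℕ → FreeGroup ι →* Matrix.SpecialLinearGroup (Fin 2) ℚ[X])

/-- The entries of the images of the generators under a sequence of representations. -/
noncomputable def generatorEntries (n : ℕ) (e : ι × Fin 2 × Fin 2) : ℚ[X] :=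
  (ψ n (FreeGroup.of e.1)).1 e.2.1 e.2.2

/-- The entries of the image of a word are polynomials in those of the generators, which do not
depend on the representation. -/
theorem exists_matrix_mvPolynomial (w : FreeGroup ι) :
    ∃ P : Matrix (Fin 2) (Fin 2) (MvPolynomial (ι × Fin 2 × Fin 2) ℚ),
      ∀ n, (ψ n w).1 = (MvPolynomial.aeval (generatorEntries ψ n)).mapMatrix P := by
  have hinv : ∀ w, (∃ P : Matrix (Fin 2) (Fin 2) (MvPolynomial (ι × Fin 2 × Fin 2) ℚ),
      ∀ n, (ψ n w).1 = (MvPolynomial.aeval (generatorEntries ψ n)).mapMatrix P) →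
      ∃ P : Matrix (Fin 2) (Fin 2) (MvPolynomial (ι × Fin 2 × Fin 2) ℚ),
      ∀ n, (ψ n w⁻¹).1 = (MvPolynomial.aeval (generatorEntries ψ n)).mapMatrix P := by
    rintro w ⟨P, hP⟩
    refine ⟨P.adjugate, fun n => ?_⟩
    rw [map_inv, Matrix.SpecialLinearGroup.coe_inv, hP, AlgHom.map_adjugate]
  induction w using FreeGroup.induction_on with
  | C1 =>
    refine ⟨1, fun n => ?_⟩
    rw [map_one, map_one, Matrix.SpecialLinearGroup.coe_one]
  | of x =>
    refine ⟨Matrix.of fun i j => MvPolynomial.X (x, i, j), fun n => ?_⟩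
    ext1 i j
    simp [generatorEntries]
  | inv_of x ih => exact hinv _ ih
  | mul x y hx hy =>
    obtain ⟨P, hP⟩ := hx
    obtain ⟨Q, hQ⟩ := hy
    refine ⟨P * Q, fun n => ?_⟩
    rw [map_mul, map_mul, Matrix.SpecialLinearGroup.coe_mul, hP, hQ]

theorem ofSeq_entryDegree_mem_range (w : FreeGroup ι) :
    (Hyperreal.ofSeq fun n => (entryDegree (ψ n w).1 : ℝ)) ∈
      Set.range (asymptoticDegree (generatorEntries ψ)) := by
  obtain ⟨P, hP⟩ := exists_matrix_mvPolynomial ψ w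
  have h : ∀ᶠ n in hyperfilter ℕ, ∃ e : Fin 2 × Fin 2,
      entryDegree (ψ n w).1 = ((ψ n w).1 e.1 e.2).natDegree :=
    .of_forall fun n => by
      obtain ⟨i, j, hij⟩ := exists_natDegree_eq_entryDegree (ψ n w).1
      exact ⟨(i, j), hij⟩
  obtain ⟨e, he⟩ := Ultrafilter.eventually_exists_iff.1 h
  refine ⟨P e.1 e.2, Hyperreal.ofSeq_eq_ofSeq.2 (he.mono fun n hn => ?_)⟩
  rw [hn, hP n]
  rfl

end Limit

/-! ### The free action of a limit group -/

section Main

open Matrix Polynomial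

/-- A countable free group has a representation in `SL₂(ℚ[X])` in which all nontrivial elements
have nonconstant trace. -/
theorem IsFreeGroup.exists_natDegree_trace_pos (G : Type*) [Group G] [IsFreeGroup G]
    [Countable G] : ∃ ρ : G →* Matrix.SpecialLinearGroup (Fin 2) ℚ[X],
      ∀ g, g ≠ 1 → 0 < (trace (ρ g).1).natDegree := by
  have : Countable (IsFreeGroup.Generators G) := (IsFreeGroup.basis G).injective.countable
  obtain ⟨p, hp⟩ := exists_injective_nat (IsFreeGroup.Generators G × Bool)
  refine ⟨(schottkyHom fun e => (p e : ℚ)).comp (IsFreeGroup.toFreeGroup G).toMonoidHom,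
    fun g hg => natDegree_trace_schottkyHom_pos (Nat.cast_injective.comp hp) ?_⟩
  simpa using hg

theorem MarkedGroup.lift_marking_surjective {k : ℕ} (G : MarkedGroup.{u} k) :
    Function.Surjective (FreeGroup.lift G.marking) := by
  rw [← MonoidHom.range_eq_top, FreeGroup.range_lift_eq_closure, G.generates]

instance {k : ℕ} (G : MarkedGroup.{u} k) : Countable G.carrier :=
  G.lift_marking_surjective.countable

theorem MarkedGroup.eventually_lift_eq_one_iff {k : ℕ} {G : MarkedGroup.{u} k}
    {F : ℕ → MarkedGroup.{u} k}
    (hF : Tendsto (fun i => MarkedGroupSpace.mk (F i)) atTop (𝓝 (MarkedGroupSpace.mk G)))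
    (w : FreeGroup (Fin k)) :
    ∀ᶠ i in atTop, (FreeGroup.lift G.marking w = 1 ↔ FreeGroup.lift (F i).marking w = 1) := by
  have h := hF.eventually ((MarkedGroupSpace.nhds_hasBasis _).mem_of_mem (i := w.norm) trivial)
  exact h.mono fun i hi => hi w le_rfl

/-- A limit group carries a length function whose values lie in a finite-dimensional rational
vector space of hyperreal numbers. -/
theorem IsLimitGroup.exists_isFreeLength {Γ : Type u} [Group Γ] (hΓ : IsLimitGroup Γ) :
    ∃ (V : Submodule ℚ Hyperreal) (ℓ : Γ → Hyperreal), FiniteDimensional ℚ V ∧ IsFreeLength ℓ ∧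
      ∀ g, ℓ g ∈ V := by
  obtain ⟨k, s, hs, F, hfree, hF⟩ := hΓ
  choose ρ hρ using fun i => IsFreeGroup.exists_natDegree_trace_pos (F i).carrier
  set ψ := fun i => (ρ i).comp (FreeGroup.lift (F i).marking)
  have hπ : Function.Surjective (FreeGroup.lift s) :=
    MarkedGroup.lift_marking_surjective ⟨Γ, s, hs⟩
  have hev : ∀ w, ∀ᶠ i in hyperfilter ℕ,
      (FreeGroup.lift s w = 1 ↔ FreeGroup.lift (F i).marking w = 1) := fun w =>
    Nat.hyperfilter_le_atTop (MarkedGroup.eventually_lift_eq_one_iff hF w)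
  obtain ⟨ℓ, hℓ, hval⟩ := _root_.exists_isFreeLength hπ ψ
    (fun w hw => (hev w).mono fun i hi => by
      rw [MonoidHom.comp_apply, hi.1 hw, map_one])
    (fun w hw => (hev w).mono fun i hi => hρ i _ (hi.not.1 hw))
  refine ⟨Submodule.span ℚ (Set.range (asymptoticDegree (generatorEntries ψ))), ℓ,
    finiteDimensional_span_asymptoticDegree _, hℓ, fun g => Submodule.subset_span ?_⟩
  obtain ⟨w, rfl⟩ := hπ g
  rw [hval]
  exact ofSeq_entryDegree_mem_range ψ w

theorem mainTheorem4 (Γ : Type u) [Group Γ] (hΓ : IsLimitGroup Γ) :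
    ∃ (n : ℕ) (T : Type u) (_ : LambdaMetricSpace (LexReal n) T) (_ : MulAction Γ T),
      Nonempty T ∧ IsLambdaTree (LexReal n) T ∧ IsFreeIsometricAction (LexReal n) Γ T := by
  obtain ⟨V, ℓ, hfin, hℓ, hV⟩ := hΓ.exists_isFreeLength
  have : IsOrderedModule ℚ V := IsOrderedModule.of_smul_nonneg (α := ℚ) (β := V) fun a ha x hx => by
    change (0 : Hyperreal) ≤ a • (x : Hyperreal)
    rw [Rat.smul_def]
    exact mul_nonneg (Rat.cast_nonneg.2 ha) hx
  obtain ⟨n, φ, hφ⟩ := exists_strictMono_lexReal (M := V)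
  have h := hℓ.map (V := V.toAddSubgroup) hV φ hφ
  refine ⟨n, h.Tree, TightSpan.lambdaMetricSpace h.isZeroHyperbolic, h.mulAction, h.nonempty_tree,
    TightSpan.isLambdaTree h.isZeroHyperbolic fun a => ⟨(2⁻¹ : ℝ) • a, ?_⟩,
    h.isFreeIsometricAction⟩
  rw [← Nat.cast_smul_eq_nsmul ℝ, smul_smul]
  norm_num

end Main
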